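/- **Setting.** Consider a one-dimensional controlled system on $[0,T]$ with dynamics $dx(t)=f^*(x(t),u(t))\,dt+\sigma\,dw(t)$, $u(t)=\pi(x(t))$, $x(0)\sim q$, where $w$ is a standard Brownian motion, with a policy class $\Pi$, a class $\mathcal Q$ of initial distributions, a class $\mathcal F\ni f^*$ of drift functions and a class $\mathcal R\ni b^*$ of reward functions of $z=(x,u)$. Write $Z(t)=(x(t),\pi(x(t)))$. Let $\hat Z=Z(t)$ with $t\sim\mathrm{Unif}[0,T]$ independent of the trajectory, and, for a sampler $\mathcal T$ (a joint distribution of times $t_1,\dots,t_m\in[0,T]$, drawn independently of the trajectory), let $\bar Z_i=Z(t_i)$ be the measurements along one trajectory. The independency coefficient of $\mathcal T$ is $C_{\mathcal T,m}=\sup_{1\le i\le m}\max\{C_{\mathcal F,i},C_{\mathcal R,i}\}$, where $$C_{\mathcal F,i}=\sup\frac{\mathbb E\,|f(\hat Z)-f^*(\hat Z)|^2}{\mathbb E\big[|f(\bar Z_i)-f^*(\bar Z_i)|^2\,\big|\,\bar Z_{i-1},\dots,\bar Z_1\big]},\qquad C_{\mathcal R,i}=\sup\frac{\mathbb E\,(b(\hat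 Z)-b^*(\hat Z))^2}{\mathbb E\big[(b(\bar Z_i)-b^*(\bar Z_i))^2\,\big|\,\bar Z_{i-1},\dots,\bar Z_1\big]},$$ the suprema being over $\pi\in\Pi$, $q\in\mathcal Q$, the values of $\bar Z_{i-1},\dots,\bar Z_1$ (essential supremum) and $f\in\mathcal F$, respectively $b\in\mathcal R$, with the convention $0/0=1$. **Proposition.** Let $0<u_{\min}\le u_{\max}$, and consider the Ornstein–Uhlenbeck system $$dx(t)=-u\,x(t)\,dt+\sqrt2\,dw(t),\qquad x(0)=0,$$ with one-dimensional control space $[u_{\min},u_{\max}]$, where $\Pi$ consists of the constant policies $\pi\equiv u$ with $u\in[u_{\min},u_{\max}]$, $\mathcal Q=\{\delta_0\}$, $\mathcal F=\{f^*\}$ with $f^*(x,u)=-ux$, $\mathcal R=\{(x,u)\mapsto\alpha x: 0\le\alpha\le1\}$ and $b^*(x,u)=x$. Then for every $T>0$ and every integer $m\ge1$, the equispaced sampler $\mathcal T$, with the deterministic times $t_i=\frac{i}{m}T$, $1\le i\le m$, satisfies $$C_{\mathcal T,m}\le 1+\frac{m}{2Tu_{\min}}.$$ Consequently, $C_{\mathcal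 T,m}\le2$ whenever $m\le 2Tu_{\min}$. -/

import Mathlib

open MeasureTheory ProbabilityTheory
open scoped NNReal ENNReal

noncomputable section

namespace CTRL

/-- A one-dimensional controlled system `dx(t) = f⋆(x(t), u(t)) dt + σ dw(t)`, `u(t) = π(x(t))`,
with state space `ℝ`, a set of controls in `ℝ` and constant diffusion coefficient `σ`, together
with the classes that a learner works with: feedback policies, initial distributions, drift
functions and reward functions of `z = (x, u)`. -/
structure ControlSystem where
  /-- the control space -/
  controls : Set ℝ
  /-- the policy class -/
  policies : Set (ℝ → ℝ)
  policies_measurable : ∀ π ∈ policies, Measurable π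
  policies_mem : ∀ π ∈ policies, ∀ x, π x ∈ controls
  /-- the class of initial distributions -/
  initials : Set (ProbabilityMeasure ℝ)
  /-- the class of drift functions -/
  driftClass : Set (ℝ × ℝ → ℝ)
  /-- the true drift -/
  drift : ℝ × ℝ → ℝ
  drift_mem : drift ∈ driftClass
  /-- the diffusion coefficient -/
  diffusion : ℝ
  /-- the class of reward functions -/
  rewardClass : Set (ℝ × ℝ → ℝ)
  /-- the true reward -/
  reward : ℝ × ℝ → ℝ
  reward_mem : reward ∈ rewardClass

/-- A trajectory of the system on `[0, T]` under the policy `π` and the initial distribution `q`: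
a filtered probability space with a Brownian motion `w` for the filtration, and an adapted
continuous process `X` with `X 0 ∼ q` and, almost surely, for all `t ∈ [0, T]`,
`X t = X 0 + ∫₀ᵗ f⋆(X s, π (X s)) ds + σ w t` (a weak solution of the stochastic differential
equation; as the diffusion coefficient is a constant, its stochastic integral is `σ w t`). -/
structure Trajectory (S : ControlSystem) (π : ℝ → ℝ) (q : ProbabilityMeasure ℝ) (T : ℝ≥0) where
  /-- the sample space -/
  Ω : Type
  [mΩ : MeasurableSpace Ω]
  /-- the probability -/
  P : Measure Ω
  [isProb : IsProbabilityMeasure P]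
  /-- the filtration -/
  𝓕 : Filtration ℝ≥0 mΩ
  /-- the driving Brownian motion -/
  w : ℝ≥0 → Ω → ℝ
  /-- the state process -/
  X : ℝ≥0 → Ω → ℝ
  brownian : IsBrownianReal w P
  brownian_adapted : ∀ t, Measurable[𝓕 t] (w t)
  brownian_indep : ∀ s t, s ≤ t →
    Indep (MeasurableSpace.comap (fun ω => w t ω - w s ω) inferInstance) (𝓕 s) P
  adapted : ∀ t, Measurable[𝓕 t] (X t)
  continuous : ∀ ω, Continuous fun t => X t ω
  initial : P.map (X 0) = (q : Measure ℝ)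
  equation : ∀ᵐ ω ∂P, ∀ t ≤ T,
    IntervalIntegrable (fun s : ℝ => S.drift (X s.toNNReal ω, π (X s.toNNReal ω))) volume 0 t ∧
    X t ω = X 0 ω + (∫ s in (0 : ℝ)..t, S.drift (X s.toNNReal ω, π (X s.toNNReal ω)))
      + S.diffusion * w t ω

attribute [instance] Trajectory.mΩ Trajectory.isProb

/-- A sampler: the joint distribution of `m` measurement times in `[0, T]`. -/
abbrev Sampler (T : ℝ≥0) (m : ℕ) := ProbabilityMeasure (Fin m → Set.Icc (0 : ℝ≥0) T)

/-- The quotient `a / b` in `[0, ∞]`, with the convention that it is `1` if `a = b`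
(this only matters for `0 / 0` and `∞ / ∞`). -/
def ratio (a b : ℝ≥0∞) : ℝ≥0∞ := open Classical in if a = b then 1 else a / b

namespace Trajectory

variable {S : ControlSystem} {π : ℝ → ℝ} {q : ProbabilityMeasure ℝ} {T : ℝ≥0} {m : ℕ}

/-- The state-control process `Z t = (X t, π (X t))`. -/
def Z (Y : Trajectory S π q T) (t : ℝ≥0) (ω : Y.Ω) : ℝ × ℝ := (Y.X t ω, π (Y.X t ω))

/-- The law of `Z t` for a time `t` uniform on `[0, T]` and independent of the trajectory. -/
def uniformLaw (Y : Trajectory S π q T) : Measure (ℝ × ℝ) :=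
  (Y.P.prod (volume[|Set.Icc (0 : ℝ) T])).map fun p => Y.Z p.2.toNNReal p.1

/-- The joint law of a trajectory and of measurement times drawn independently from `𝒯`. -/
def sampleMeasure (Y : Trajectory S π q T) (𝒯 : Sampler T m) :
    Measure (Y.Ω × (Fin m → Set.Icc (0 : ℝ≥0) T)) :=
  Y.P.prod (𝒯 : Measure (Fin m → Set.Icc (0 : ℝ≥0) T))

instance (Y : Trajectory S π q T) (𝒯 : Sampler T m) : IsProbabilityMeasure (Y.sampleMeasure 𝒯) := by
  unfold sampleMeasure; infer_instance

/-- The `i`-th measurement, `Z` at the `i`-th measurement time. -/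
def sample (Y : Trajectory S π q T) (i : Fin m)
    (p : Y.Ω × (Fin m → Set.Icc (0 : ℝ≥0) T)) : ℝ × ℝ := Y.Z (p.2 i) p.1

/-- The measurements that precede the `i`-th one. -/
def history (Y : Trajectory S π q T) (i : Fin m)
    (p : Y.Ω × (Fin m → Set.Icc (0 : ℝ≥0) T)) : Set.Iio i → ℝ × ℝ := fun j => Y.sample j p

/-- The regular conditional law of the `i`-th measurement given the preceding ones. -/
def condLaw (Y : Trajectory S π q T) (𝒯 : Sampler T m) (i : Fin m) :
    Kernel (Set.Iio i → ℝ × ℝ) (ℝ × ℝ) :=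
  condDistrib (Y.sample i) (Y.history i) (Y.sampleMeasure 𝒯)

/-- The largest quotient, over the values of the preceding measurements, of the mean squared error
of `g` against `g₀` at a uniform time by the conditional mean squared error at the `i`-th
measurement. The conditional law being unique only almost everywhere, the supremum over the values
is the essential one for the law of the preceding measurements. -/
def errorRatio (Y : Trajectory S π q T) (𝒯 : Sampler T m) (i : Fin m) (g₀ g : ℝ × ℝ → ℝ) : ℝ≥0∞ :=
  essSup (fun h => ratio (∫⁻ z, ENNReal.ofReal ((g z - g₀ z) ^ 2) ∂Y.uniformLaw)
      (∫⁻ z, ENNReal.ofReal ((g z - g₀ z) ^ 2) ∂(Y.condLaw 𝒯 i h)))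
    ((Y.sampleMeasure 𝒯).map (Y.history i))

end Trajectory

namespace ControlSystem

/-- The coefficient of the `i`-th measurement for a function class `𝒢` with true function `g₀`:
the supremum over policies, initial distributions, trajectories and functions of the class. -/
def classCoeff (S : ControlSystem) {T : ℝ≥0} {m : ℕ} (𝒯 : Sampler T m) (i : Fin m)
    (𝒢 : Set (ℝ × ℝ → ℝ)) (g₀ : ℝ × ℝ → ℝ) : ℝ≥0∞ :=
  ⨆ π ∈ S.policies, ⨆ q ∈ S.initials, ⨆ (Y : Trajectory S π q T), ⨆ g ∈ 𝒢, Y.errorRatio 𝒯 i g₀ g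

/-- The independency coefficient of a sampler. -/
def independencyCoeff (S : ControlSystem) {T : ℝ≥0} {m : ℕ} (𝒯 : Sampler T m) : ℝ≥0∞ :=
  ⨆ i : Fin m, max (S.classCoeff 𝒯 i S.driftClass S.drift) (S.classCoeff 𝒯 i S.rewardClass S.reward)

end ControlSystem

/-- The equispaced sampler: the deterministic times `T/m, 2T/m, …, T`. -/
def equispacedSampler (T : ℝ≥0) (m : ℕ) : Sampler T m :=
  ⟨Measure.dirac fun i => ⟨((i : ℕ) + 1 : ℝ≥0) / m * T, zero_le, by
    refine mul_le_of_le_one_left zero_le (div_le_one_of_le₀ ?_ zero_le)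
    exact_mod_cast i.2⟩, inferInstance⟩

/-- The Ornstein–Uhlenbeck system `dx = -u x dt + √2 dw`, `x(0) = 0`, with constant controls
`u ∈ [umin, umax]`, known drift, reward class `{α x : 0 ≤ α ≤ 1}` and true reward `x`. -/
def ouSystem (umin umax : ℝ) : ControlSystem where
  controls := Set.Icc umin umax
  policies := {π | ∃ u ∈ Set.Icc umin umax, π = fun _ => u}
  policies_measurable := by rintro _ ⟨u, _, rfl⟩; exact measurable_const
  policies_mem := by rintro _ ⟨u, hu, rfl⟩ _; exact hu
  initials := {⟨Measure.dirac 0, inferInstance⟩}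
  driftClass := {fun z => -z.2 * z.1}
  drift := fun z => -z.2 * z.1
  drift_mem := rfl
  diffusion := √2
  rewardClass := {b | ∃ α ∈ Set.Icc (0 : ℝ) 1, b = fun z => α * z.1}
  reward := fun z => z.1
  reward_mem := ⟨1, by norm_num, by simp⟩

end CTRL

end

/-! Under the constant policy `u`, given the past up to time `s`, the Ornstein–Uhlenbeck state at
time `t` has mean `e^{-u(t-s)} X s` and variance `(1 - e^{-2u(t-s)})/u`. A conditional second moment
is at least the conditional variance, so with gap `T/m` every denominator is at least `(1 -
e^{-2uT/m})/u` times the squared slope of the error. Started at `0`, the state has second moment at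
most `1/u` at all times, which bounds the numerator. A reward error is `(α - 1) x`, so its slope
cancels, and `1/(1 - e^{-y}) ≤ 1 + 1/y` at `y = 2uT/m` gives the bound, which is worst at `u =
umin`. The drift is known, so its quotient is `0/0 = 1`.

Only second moments are needed, so neither Itô's formula nor the Gaussian law of the state is used.
The integral equation is tested against square integrable variables and averaged. This gives linear
Volterra equations in time, solved by uniqueness (`volterra_unique`). The outcome,
`integral_indicator_path_sq`, is the conditional second moment localized to an event of the past,
and `setLIntegral_condLaw` transfers it to the conditional laws of the measurements. -/

namespace CTRL

/-! ### Linear Volterra equations and elementary inequalities -/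

/-- The homogeneous linear Volterra equation `d t = -u ∫ₛᵗ d` only has the zero solution. -/
theorem volterra_eq_zero {u s T : ℝ} {d : ℝ → ℝ} (hd : IntervalIntegrable d volume s T)
    (h : ∀ t ∈ Set.Icc s T, d t = -u * ∫ r in s..t, d r) : ∀ t ∈ Set.Icc s T, d t = 0 := by
  intro t ht
  have hsT : s ≤ T := ht.1.trans ht.2
  have hcont : ContinuousOn d (Set.Icc s T) := by
    have h1 := intervalIntegral.continuousOn_primitive_interval' hd Set.left_mem_uIcc
    rw [Set.uIcc_of_le hsT] at h1
    exact (h1.const_mul (-u)).congr h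
  -- The continuous extension of `d` beyond `[s, T]` makes its primitive differentiable at the
  -- endpoints too.
  set D : ℝ → ℝ := Set.IccExtend hsT (Set.domRestrict (Set.Icc s T) d) with hD
  have hDc : Continuous D := hcont.domRestrict.Icc_extend'
  have hDd : ∀ r ∈ Set.Icc s T, D r = d r := fun r hr => by
    rw [hD, Set.IccExtend_of_mem hsT _ hr, Set.domRestrict_apply]
  have hDi : ∀ r ∈ Set.Icc s T, ∫ a in s..r, D a = ∫ a in s..r, d a := fun r hr => by
    refine intervalIntegral.integral_congr fun a ha => ?_
    rw [Set.uIcc_of_le hr.1] at ha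
    exact hDd a ⟨ha.1, ha.2.trans hr.2⟩
  -- Integrating factor: by the equation, `e^{ur} ∫ₛʳ d` has zero derivative on `[s, T)`.
  have hderiv : ∀ r, HasDerivAt (fun r => Real.exp (u * r) * ∫ a in s..r, D a)
      (Real.exp (u * r) * u * (∫ a in s..r, D a) + Real.exp (u * r) * D r) r := fun r => by
    have h1 : HasDerivAt (fun r => Real.exp (u * r)) (Real.exp (u * r) * u) r := by
      simpa using ((hasDerivAt_id r).const_mul u).exp
    exact h1.mul (intervalIntegral.integral_hasDerivAt_right (hDc.intervalIntegrable _ _)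
      hDc.stronglyMeasurable.stronglyMeasurableAtFilter hDc.continuousAt)
  have hconst := constant_of_has_deriv_right_zero (a := s) (b := T)
    (f := fun r => Real.exp (u * r) * ∫ a in s..r, D a)
    (fun r _ => (hderiv r).continuousAt.continuousWithinAt) (fun r hr => by
      have hr' : r ∈ Set.Icc s T := ⟨hr.1, hr.2.le⟩
      have := (hderiv r).hasDerivWithinAt (s := Set.Ici r)
      rwa [hDd r hr', h r hr', ← hDi r hr', show Real.exp (u * r) * u * (∫ a in s..r, D a)
        + Real.exp (u * r) * (-u * ∫ a in s..r, D a) = 0 by ring] at this) t ht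
  simp only [intervalIntegral.integral_same, mul_zero, mul_eq_zero, Real.exp_ne_zero,
    false_or] at hconst
  rw [h t ht, ← hDi t ht, hconst, mul_zero]

/-- Uniqueness for the linear Volterra equation `d t = c t - u ∫ₛᵗ d`. -/
theorem volterra_unique {u s T : ℝ} {c d e : ℝ → ℝ} (hd : IntervalIntegrable d volume s T)
    (he : IntervalIntegrable e volume s T)
    (h : ∀ t ∈ Set.Icc s T, d t = c t - u * ∫ r in s..t, d r)
    (h' : ∀ t ∈ Set.Icc s T, e t = c t - u * ∫ r in s..t, e r) :
    ∀ t ∈ Set.Icc s T, d t = e t := by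
  intro t ht
  refine sub_eq_zero.1 (volterra_eq_zero (u := u) (d := fun r => d r - e r) (hd.sub he)
    (fun r hr => ?_) t ht)
  have hsub : Set.uIcc s r ⊆ Set.uIcc s T := by
    rw [Set.uIcc_of_le hr.1, Set.uIcc_of_le (hr.1.trans hr.2)]
    exact Set.Icc_subset_Icc_right hr.2
  rw [intervalIntegral.integral_sub (hd.mono_set hsub) (he.mono_set hsub), h r hr, h' r hr]
  ring

theorem integral_exp_const_mul {k : ℝ} (hk : k ≠ 0) (s t : ℝ) :
    ∫ r in s..t, Real.exp (k * r) = (Real.exp (k * t) - Real.exp (k * s)) / k := by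
  rw [intervalIntegral.integral_comp_mul_left (fun r => Real.exp r) hk, integral_exp, smul_eq_mul]
  ring

/-- With `I` the primitive of `y`, `I² = ∫ 2 I y`, and `2 u I y ≤ (y + u I)²` bounds `u I²` by the
integrated squared forcing. Then `y = (y + u I) - u I`. This is the pathwise energy estimate behind
the a priori moment bound. -/
theorem sq_le_of_linear_forcing {u : ℝ} (hu : 0 < u) {y : ℝ → ℝ} (hy : Continuous y) {t : ℝ}
    (ht : 0 ≤ t) :
    y t ^ 2 ≤ 2 * (y t + u * ∫ r in (0 : ℝ)..t, y r) ^ 2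
      + 2 * u * ∫ a in (0 : ℝ)..t, (y a + u * ∫ r in (0 : ℝ)..a, y r) ^ 2 := by
  set I : ℝ → ℝ := fun a => ∫ r in (0 : ℝ)..a, y r with hI
  have hId : ∀ a, HasDerivAt I (y a) a := fun a =>
    intervalIntegral.integral_hasDerivAt_right (hy.intervalIntegrable _ _)
      hy.stronglyMeasurable.stronglyMeasurableAtFilter hy.continuousAt
  have hIc : Continuous I := continuous_iff_continuousAt.2 fun a => (hId a).continuousAt
  have hsq : ∫ a in (0 : ℝ)..t, 2 * I a * y a = I t ^ 2 := by
    rw [intervalIntegral.integral_eq_sub_of_hasDerivAt (f := fun a => I a ^ 2)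
      (fun a _ => by simpa using (hId a).fun_pow 2)
      ((by fun_prop : Continuous fun a => 2 * I a * y a).intervalIntegrable _ _)]
    simp [hI]
  have hle : I t ^ 2 ≤ ∫ a in (0 : ℝ)..t, (y a + u * I a) ^ 2 / u := by
    rw [← hsq]
    refine intervalIntegral.integral_mono_on ht
      ((by fun_prop : Continuous fun a => 2 * I a * y a).intervalIntegrable _ _)
      ((by fun_prop : Continuous fun a => (y a + u * I a) ^ 2 / u).intervalIntegrable _ _)
      fun a _ => ?_
    rw [le_div_iff₀ hu]
    nlinarith [sq_nonneg (y a), sq_nonneg (u * I a)]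
  rw [intervalIntegral.integral_div, le_div_iff₀ hu] at hle
  change y t ^ 2 ≤ 2 * (y t + u * I t) ^ 2 + 2 * u * ∫ a in (0 : ℝ)..t, (y a + u * I a) ^ 2
  nlinarith [sq_nonneg (y t + 2 * (u * I t))]

/-- `1 / (1 - e^{-y}) ≤ 1 + 1 / y`. -/
theorem one_le_one_add_inv_mul {y : ℝ} (hy : 0 < y) : 1 ≤ (1 + 1 / y) * (1 - Real.exp (-y)) := by
  have h1 : (1 + y) * Real.exp (-y) ≤ 1 := by
    rw [Real.exp_neg, ← div_eq_mul_inv, div_le_one (Real.exp_pos y)]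
    linarith [Real.add_one_le_exp y]
  have : (1 + 1 / y) * (1 - Real.exp (-y)) = (1 + y - (1 + y) * Real.exp (-y)) / y := by
    field_simp
    ring
  rw [this, le_div_iff₀ hy]
  linarith

/-! ### Moments and independence of Brownian increments -/

namespace Trajectory

section Increments

variable {S : ControlSystem} {π : ℝ → ℝ} {q : ProbabilityMeasure ℝ} {T : ℝ≥0}
  (Y : Trajectory S π q T)

theorem hasLaw_increment {s t : ℝ≥0} (h : s ≤ t) :
    HasLaw (fun ω => Y.w t ω - Y.w s ω) (gaussianReal 0 (t - s)) Y.P := by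
  have h1 := Y.brownian.toIsPreBrownianReal.hasLaw_sub t s
  have h2 : nndist t.1 s.1 = t - s := by
    ext
    rw [coe_nndist, Real.dist_eq, NNReal.coe_sub h]
    exact abs_of_nonneg (sub_nonneg.2 (NNReal.coe_le_coe.2 h))
  rwa [h2] at h1

theorem measurable_increment (s t : ℝ≥0) : Measurable fun ω => Y.w t ω - Y.w s ω :=
  ((Y.brownian_adapted t).mono (Y.𝓕.le t) le_rfl).sub
    ((Y.brownian_adapted s).mono (Y.𝓕.le s) le_rfl)

theorem memLp_increment {s t : ℝ≥0} (h : s ≤ t) :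
    MemLp (fun ω => Y.w t ω - Y.w s ω) 2 Y.P := by
  have h1 := memLp_id_gaussianReal (μ := 0) (v := t - s) 2
  rw [← (Y.hasLaw_increment h).map_eq] at h1
  exact h1.comp_of_map (Y.measurable_increment s t).aemeasurable

theorem integral_increment {s t : ℝ≥0} (h : s ≤ t) : ∫ ω, (Y.w t ω - Y.w s ω) ∂Y.P = 0 := by
  rw [(Y.hasLaw_increment h).integral_eq, integral_id_gaussianReal]

theorem integral_increment_sq {s t : ℝ≥0} (h : s ≤ t) :
    ∫ ω, (Y.w t ω - Y.w s ω) ^ 2 ∂Y.P = t - s := by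
  have h1 := (Y.hasLaw_increment h).variance_eq
  rw [variance_id_gaussianReal, variance_of_integral_eq_zero
    (Y.measurable_increment s t).aemeasurable (Y.integral_increment h)] at h1
  rw [h1, NNReal.coe_sub h]

theorem indepFun_increment {s t : ℝ≥0} (h : s ≤ t) {η : Y.Ω → ℝ} (hη : Measurable[Y.𝓕 s] η) :
    IndepFun η (fun ω => Y.w t ω - Y.w s ω) Y.P :=
  (indep_of_indep_of_le_right (Y.brownian_indep s t h) hη.comap_le).symm

theorem integral_mul_increment {s t : ℝ≥0} (h : s ≤ t) {η : Y.Ω → ℝ}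
    (hη : Measurable[Y.𝓕 s] η) : ∫ ω, η ω * (Y.w t ω - Y.w s ω) ∂Y.P = 0 := by
  rw [(Y.indepFun_increment h hη).integral_fun_mul_eq_mul_integral
    (hη.mono (Y.𝓕.le s) le_rfl).aestronglyMeasurable
    (Y.measurable_increment s t).aestronglyMeasurable, Y.integral_increment h, mul_zero]

theorem integral_mul_increment_sq {s t : ℝ≥0} (h : s ≤ t) {η : Y.Ω → ℝ}
    (hη : Measurable[Y.𝓕 s] η) :
    ∫ ω, η ω * (Y.w t ω - Y.w s ω) ^ 2 ∂Y.P = (∫ ω, η ω ∂Y.P) * (t - s) := by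
  rw [← Y.integral_increment_sq h]
  exact ((Y.indepFun_increment h hη).comp measurable_id (measurable_id.pow_const 2)
    ).integral_fun_mul_eq_mul_integral (hη.mono (Y.𝓕.le s) le_rfl).aestronglyMeasurable
    ((Y.measurable_increment s t).pow_const 2).aestronglyMeasurable

/-- The covariance of two increments from the same time, localized to an event of the past. -/
theorem integral_indicator_increment_mul_increment {s r t : ℝ≥0} (hsr : s ≤ r) (hrt : r ≤ t)
    {A : Set Y.Ω} (hA : MeasurableSet[Y.𝓕 s] A) :
    ∫ ω, A.indicator (fun ω => Y.w t ω - Y.w s ω) ω * (Y.w r ω - Y.w s ω) ∂Y.P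
      = Y.P.real A * (r - s) := by
  have hA' : MeasurableSet A := Y.𝓕.le s A hA
  -- Split `w t - w s` at `r`: the part after `r` is independent of `𝓕 r` and centred, so only the
  -- square up to `r` contributes.
  have hsplit : ∀ ω, A.indicator (fun ω => Y.w t ω - Y.w s ω) ω * (Y.w r ω - Y.w s ω)
      = A.indicator (fun ω => Y.w r ω - Y.w s ω) ω * (Y.w t ω - Y.w r ω)
        + A.indicator 1 ω * (Y.w r ω - Y.w s ω) ^ 2 := fun ω => by
    by_cases h : ω ∈ A <;> simp [h]
    ring
  have hm : Measurable[Y.𝓕 r] (A.indicator fun ω => Y.w r ω - Y.w s ω) :=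
    ((Y.brownian_adapted r).sub ((Y.brownian_adapted s).mono (Y.𝓕.mono hsr) le_rfl)).indicator
      (Y.𝓕.mono hsr A hA)
  simp only [hsplit]
  rw [integral_add, Y.integral_mul_increment hrt hm, zero_add,
    Y.integral_mul_increment_sq hsr (η := A.indicator 1) (Measurable.indicator (@measurable_const _ _ _ (Y.𝓕 s) 1) hA),
    integral_indicator_one hA']
  · exact ((Y.memLp_increment hsr).indicator hA').integrable_mul (Y.memLp_increment hrt)
  · refine ((Y.memLp_increment hsr).integrable_sq.indicator hA').congr (.of_forall fun ω => ?_)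
    by_cases h : ω ∈ A <;> simp [h]

end Increments

/-! ### Real-time indexing and the integral equation -/

section Path

variable {S : ControlSystem} {π : ℝ → ℝ} {q : ProbabilityMeasure ℝ} {T : ℝ≥0}
  (Y : Trajectory S π q T)

/-- The state process, indexed by real times. -/
def path (r : ℝ) (ω : Y.Ω) : ℝ := Y.X r.toNNReal ω

/-- The increment of the Brownian motion, indexed by real times. -/
def incr (s t : ℝ) (ω : Y.Ω) : ℝ := Y.w t.toNNReal ω - Y.w s.toNNReal ω

theorem continuous_path (ω : Y.Ω) : Continuous fun r => Y.path r ω :=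
  (Y.continuous ω).comp continuous_real_toNNReal

theorem measurable_path (r : ℝ) : Measurable (Y.path r) :=
  (Y.adapted _).mono (Y.𝓕.le _) le_rfl

theorem measurable_uncurry_path : Measurable (Function.uncurry Y.path) :=
  measurable_uncurry_of_continuous_of_measurable Y.continuous_path Y.measurable_path

end Path

section OrnsteinUhlenbeck

variable {umin umax u : ℝ} {q : ProbabilityMeasure ℝ} {T : ℝ≥0}
  (Y : Trajectory (ouSystem umin umax) (fun _ => u) q T)

theorem ae_path_eq : ∀ᵐ ω ∂Y.P, ∀ t ∈ Set.Icc (0 : ℝ) T,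
    Y.path t ω = Y.path 0 ω - u * (∫ r in (0 : ℝ)..t, Y.path r ω)
      + √2 * Y.w t.toNNReal ω := by
  filter_upwards [Y.equation] with ω hω t ht
  have h1 := (hω t.toNNReal (Real.toNNReal_le_iff_le_coe.2 ht.2)).2
  rw [Real.coe_toNNReal t ht.1] at h1
  simp only [ouSystem, intervalIntegral.integral_const_mul] at h1
  simp only [path, Real.toNNReal_zero]
  rw [h1]
  ring

theorem ae_path_eq_of_le {s t : ℝ} (hs : 0 ≤ s) (hst : s ≤ t) (ht : t ≤ T) :
    ∀ᵐ ω ∂Y.P, Y.path t ω = Y.path s ω - u * (∫ r in s..t, Y.path r ω)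
      + √2 * Y.incr s t ω := by
  filter_upwards [Y.ae_path_eq] with ω hω
  rw [hω t ⟨hs.trans hst, ht⟩, hω s ⟨hs, hst.trans ht⟩, incr,
    ← intervalIntegral.integral_interval_sub_left
      ((Y.continuous_path ω).intervalIntegrable 0 t) ((Y.continuous_path ω).intervalIntegrable 0 s)]
  ring

end OrnsteinUhlenbeck

end Trajectory

/-! ### Square integrability of the state and the tested equation -/

/-- A jointly measurable process with bounded second moments is square integrable on the product
of a bounded time interval with the sample space. -/
theorem memLp_uncurry_of_integral_sq_le {Ω : Type*} {mΩ : MeasurableSpace Ω} {P : Measure Ω}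
    [IsFiniteMeasure P] {f : ℝ → Ω → ℝ} (hf : Measurable (Function.uncurry f)) {a b C : ℝ}
    (hL : ∀ r ∈ Set.Ioc a b, MemLp (f r) 2 P)
    (hC : ∀ r ∈ Set.Ioc a b, ∫ ω, f r ω ^ 2 ∂P ≤ C) :
    MemLp (Function.uncurry f) 2 ((volume.restrict (Set.Ioc a b)).prod P) := by
  have hsq : Measurable fun p : ℝ × Ω => Function.uncurry f p ^ 2 := hf.pow_const 2
  rw [memLp_two_iff_integrable_sq hf.aestronglyMeasurable,
    integrable_prod_iff hsq.aestronglyMeasurable]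
  refine ⟨(ae_restrict_iff' measurableSet_Ioc).2 (.of_forall fun r hr => (hL r hr).integrable_sq),
    Integrable.of_bound (C := C)
      hsq.stronglyMeasurable.norm.integral_prod_right'.aestronglyMeasurable
      ((ae_restrict_iff' measurableSet_Ioc).2 (.of_forall fun r hr => ?_))⟩
  rw [Real.norm_of_nonneg (integral_nonneg fun _ => norm_nonneg _)]
  simpa using hC r hr

namespace Trajectory

theorem memLp_incr {S : ControlSystem} {π : ℝ → ℝ} {q : ProbabilityMeasure ℝ} {T : ℝ≥0}
    (Y : Trajectory S π q T) {s t : ℝ} (h : s ≤ t) : MemLp (Y.incr s t) 2 Y.P :=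
  Y.memLp_increment (Real.toNNReal_le_toNNReal h)

variable {umin umax u : ℝ} {q : ProbabilityMeasure ℝ} {T : ℝ≥0}
  (Y : Trajectory (ouSystem umin umax) (fun _ => u) q T)

theorem path_zero_ae_eq (hq : (q : Measure ℝ) = Measure.dirac 0) : Y.path 0 =ᵐ[Y.P] 0 := by
  have h1 : HasLaw (Y.X 0) (Measure.dirac 0) Y.P :=
    ⟨((Y.adapted 0).mono (Y.𝓕.le 0) le_rfl).aemeasurable, Y.initial.trans hq⟩
  filter_upwards [h1.ae_eq_of_dirac] with ω hω
  simpa [path] using hω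

/-- The state process with its drift removed. -/
noncomputable def forcing (r : ℝ) (ω : Y.Ω) : ℝ := Y.path r ω + u * ∫ a in (0 : ℝ)..r, Y.path a ω

theorem measurable_uncurry_forcing : Measurable (Function.uncurry Y.forcing) := by
  refine measurable_uncurry_of_continuous_of_measurable (fun ω => ?_) fun r => ?_
  · exact (Y.continuous_path ω).add ((intervalIntegral.continuous_primitive
      (fun _ _ => (Y.continuous_path ω).intervalIntegrable _ _) 0).const_mul u)
  · refine (Y.measurable_path r).add (Measurable.const_mul ?_ u)
    simp only [intervalIntegral]
    have h1 := Y.measurable_uncurry_path.stronglyMeasurable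
    exact (h1.integral_prod_left.sub h1.integral_prod_left).measurable

theorem forcing_ae_eq (hq : (q : Measure ℝ) = Measure.dirac 0) {r : ℝ} (hr : r ∈ Set.Icc (0 : ℝ) T) :
    Y.forcing r =ᵐ[Y.P] fun ω => √2 * Y.incr 0 r ω := by
  filter_upwards [Y.path_zero_ae_eq hq, Y.ae_path_eq_of_le le_rfl hr.1 hr.2] with ω h0 hω
  rw [forcing, hω, h0]
  simp

theorem memLp_forcing (hq : (q : Measure ℝ) = Measure.dirac 0) {r : ℝ}
    (hr : r ∈ Set.Icc (0 : ℝ) T) : MemLp (Y.forcing r) 2 Y.P :=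
  (memLp_congr_ae (Y.forcing_ae_eq hq hr)).2 ((Y.memLp_incr hr.1).const_mul _)

theorem integral_forcing_sq (hq : (q : Measure ℝ) = Measure.dirac 0) {r : ℝ}
    (hr : r ∈ Set.Icc (0 : ℝ) T) : ∫ ω, Y.forcing r ω ^ 2 ∂Y.P = 2 * r := by
  have h1 := Y.integral_increment_sq (Real.toNNReal_le_toNNReal hr.1)
  rw [Real.coe_toNNReal _ hr.1, Real.coe_toNNReal _ le_rfl, sub_zero] at h1
  conv_rhs => rw [← h1, ← integral_const_mul]
  refine integral_congr_ae ?_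
  filter_upwards [Y.forcing_ae_eq hq hr] with ω hω
  rw [hω, mul_pow, Real.sq_sqrt zero_le_two, incr]

/-- A weak solution comes with no moment bound. The forcing is almost surely `√2 w` at each time,
hence has second moment `2r`, and `sq_le_of_linear_forcing` carries this over to the state uniformly
on `[0, T]`. This licenses every later use of Fubini. -/
theorem exists_integral_path_sq_le (hq : (q : Measure ℝ) = Measure.dirac 0) (hu : 0 < u) :
    ∃ C, ∀ t ∈ Set.Icc (0 : ℝ) T,
      MemLp (Y.path t) 2 Y.P ∧ ∫ ω, Y.path t ω ^ 2 ∂Y.P ≤ C := by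
  have hF := (memLp_uncurry_of_integral_sq_le (C := 2 * T) Y.measurable_uncurry_forcing
    (fun r hr => Y.memLp_forcing hq ⟨hr.1.le, hr.2⟩)
    (fun r hr => by
      rw [Y.integral_forcing_sq hq ⟨hr.1.le, hr.2⟩]
      linarith [hr.2])).integrable_sq
  set G : Y.Ω → ℝ := fun ω => ∫ a in Set.Ioc (0 : ℝ) T, Y.forcing a ω ^ 2 with hG
  have hGi : Integrable G Y.P := hF.integral_prod_right
  refine ⟨(∫ ω, G ω ∂Y.P) * (2 * u) + 4 * T, fun t ht => ?_⟩
  have hle : ∀ ω, Y.path t ω ^ 2 ≤ G ω * (2 * u) + 2 * Y.forcing t ω ^ 2 := fun ω => by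
    have hc : Continuous fun a => Y.forcing a ω ^ 2 :=
      ((Y.continuous_path ω).add ((intervalIntegral.continuous_primitive
        (fun _ _ => (Y.continuous_path ω).intervalIntegrable _ _) 0).const_mul u)).pow 2
    have h1 := sq_le_of_linear_forcing hu (Y.continuous_path ω) ht.1
    have h2 : ∫ a in (0 : ℝ)..t, Y.forcing a ω ^ 2 ≤ G ω := by
      rw [intervalIntegral.integral_of_le ht.1]
      exact setIntegral_mono_set (hc.integrableOn_Ioc)
        (.of_forall fun _ => sq_nonneg _) (Set.Ioc_subset_Ioc_right ht.2).eventuallyLE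
    have h3 := mul_le_mul_of_nonneg_left h2 (by positivity : 0 ≤ 2 * u)
    simp only [forcing] at h3 ⊢
    linarith
  have hi : Integrable (fun ω => G ω * (2 * u) + 2 * Y.forcing t ω ^ 2) Y.P :=
    (hGi.mul_const _).add ((Y.memLp_forcing hq ht).integrable_sq.const_mul 2)
  have hp : Integrable (fun ω => Y.path t ω ^ 2) Y.P :=
    hi.mono' ((Y.measurable_path t).pow_const 2).aestronglyMeasurable
      (.of_forall fun ω => by rw [Real.norm_of_nonneg (sq_nonneg _)]; exact hle ω)
  refine ⟨(memLp_two_iff_integrable_sq (Y.measurable_path t).aestronglyMeasurable).2 hp,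
    (integral_mono hp hi hle).trans ?_⟩
  rw [integral_add (hGi.mul_const _) ((Y.memLp_forcing hq ht).integrable_sq.const_mul 2),
    integral_mul_const, integral_const_mul, Y.integral_forcing_sq hq ht]
  linarith [ht.2]

theorem memLp_path (hq : (q : Measure ℝ) = Measure.dirac 0) (hu : 0 < u) {t : ℝ}
    (ht : t ∈ Set.Icc (0 : ℝ) T) : MemLp (Y.path t) 2 Y.P :=
  ((Y.exists_integral_path_sq_le hq hu).choose_spec t ht).1

theorem memLp_uncurry_path (hq : (q : Measure ℝ) = Measure.dirac 0) (hu : 0 < u) {s t : ℝ}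
    (hs : 0 ≤ s) (ht : t ≤ T) :
    MemLp (Function.uncurry Y.path) 2 ((volume.restrict (Set.Ioc s t)).prod Y.P) := by
  obtain ⟨C, hC⟩ := Y.exists_integral_path_sq_le hq hu
  exact memLp_uncurry_of_integral_sq_le Y.measurable_uncurry_path
    (fun r hr => (hC r ⟨hs.trans hr.1.le, hr.2.trans ht⟩).1)
    fun r hr => (hC r ⟨hs.trans hr.1.le, hr.2.trans ht⟩).2

theorem integrable_mul_uncurry_path (hq : (q : Measure ℝ) = Measure.dirac 0) (hu : 0 < u)
    {ξ : Y.Ω → ℝ} (hξ : MemLp ξ 2 Y.P) {s t : ℝ} (hs : 0 ≤ s) (ht : t ≤ T) :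
    Integrable (fun p : ℝ × Y.Ω => ξ p.2 * Y.path p.1 p.2)
      ((volume.restrict (Set.Ioc s t)).prod Y.P) :=
  (hξ.comp_snd (volume.restrict (Set.Ioc s t))).integrable_mul (Y.memLp_uncurry_path hq hu hs ht)

/-- The equation of the state process, tested against a square integrable variable. -/
theorem integral_mul_path (hq : (q : Measure ℝ) = Measure.dirac 0) (hu : 0 < u)
    {ξ : Y.Ω → ℝ} (hξ : MemLp ξ 2 Y.P) {s t : ℝ} (hs : 0 ≤ s) (hst : s ≤ t) (ht : t ≤ T) :
    ∫ ω, ξ ω * Y.path t ω ∂Y.P = ∫ ω, ξ ω * Y.path s ω ∂Y.P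
      + √2 * (∫ ω, ξ ω * Y.incr s t ω ∂Y.P)
      - u * ∫ r in s..t, ∫ ω, ξ ω * Y.path r ω ∂Y.P := by
  have hI := Y.integrable_mul_uncurry_path hq hu hξ hs ht
  have h1 : ∫ r in s..t, ∫ ω, ξ ω * Y.path r ω ∂Y.P
      = ∫ ω, ξ ω * (∫ r in s..t, Y.path r ω) ∂Y.P := by
    rw [intervalIntegral_integral_swap (by rwa [Set.uIoc_of_le hst])]
    simp only [intervalIntegral.integral_const_mul]
  have hI' : Integrable (fun ω => ξ ω * ∫ r in s..t, Y.path r ω) Y.P := by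
    refine hI.integral_prod_right.congr (.of_forall fun ω => ?_)
    simp only [integral_const_mul, intervalIntegral.integral_of_le hst]
  have hIs : Integrable (fun ω => ξ ω * Y.path s ω) Y.P :=
    hξ.integrable_mul (Y.memLp_path hq hu ⟨hs, hst.trans ht⟩)
  have hIw : Integrable (fun ω => ξ ω * Y.incr s t ω) Y.P := hξ.integrable_mul (Y.memLp_incr hst)
  rw [h1, ← integral_const_mul, ← integral_const_mul, ← integral_add hIs (hIw.const_mul _),
    ← integral_sub (f := fun ω => ξ ω * Y.path s ω + √2 * (ξ ω * Y.incr s t ω))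
      (hIs.add (hIw.const_mul _)) (hI'.const_mul _)]
  refine integral_congr_ae ?_
  filter_upwards [Y.ae_path_eq_of_le hs hst ht] with ω hω
  rw [hω]
  ring

theorem intervalIntegrable_integral_mul_path (hq : (q : Measure ℝ) = Measure.dirac 0) (hu : 0 < u)
    {ξ : Y.Ω → ℝ} (hξ : MemLp ξ 2 Y.P) {s t : ℝ} (hs : 0 ≤ s) (hst : s ≤ t) (ht : t ≤ T) :
    IntervalIntegrable (fun r => ∫ ω, ξ ω * Y.path r ω ∂Y.P) volume s t :=
  (intervalIntegrable_iff_integrableOn_Ioc_of_le hst).2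
    (Y.integrable_mul_uncurry_path hq hu hξ hs ht).integral_prod_left

end Trajectory

/-! ### First and second moments of the state given the past -/

namespace Trajectory

variable {umin umax u : ℝ} {q : ProbabilityMeasure ℝ} {T : ℝ≥0}
  (Y : Trajectory (ouSystem umin umax) (fun _ => u) q T)

/-- The conditional mean of the state decays exponentially. -/
theorem integral_past_mul_path (hq : (q : Measure ℝ) = Measure.dirac 0) (hu : 0 < u)
    {s t : ℝ} (hs : 0 ≤ s) (hst : s ≤ t) (ht : t ≤ T) {ξ : Y.Ω → ℝ} (hξ : MemLp ξ 2 Y.P)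
    (hξm : Measurable[Y.𝓕 s.toNNReal] ξ) :
    ∫ ω, ξ ω * Y.path t ω ∂Y.P = Real.exp (-u * (t - s)) * ∫ ω, ξ ω * Y.path s ω ∂Y.P := by
  refine volterra_unique (u := u) (s := s) (T := T) (c := fun _ => ∫ ω, ξ ω * Y.path s ω ∂Y.P)
    (d := fun t => ∫ ω, ξ ω * Y.path t ω ∂Y.P)
    (e := fun t => Real.exp (-u * (t - s)) * ∫ ω, ξ ω * Y.path s ω ∂Y.P)
    (Y.intervalIntegrable_integral_mul_path hq hu hξ hs (hst.trans ht) le_rfl)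
    (Continuous.intervalIntegrable (by fun_prop) _ _) (fun r hr => ?_) (fun r hr => ?_) t ⟨hst, ht⟩
  · have h1 : ∫ ω, ξ ω * Y.incr s r ω ∂Y.P = 0 :=
      Y.integral_mul_increment (Real.toNNReal_le_toNNReal hr.1) hξm
    simp only [Y.integral_mul_path hq hu hξ hs hr.1 hr.2, h1, mul_zero, add_zero]
  · have h2 : ∀ a, Real.exp (-u * (a - s)) = Real.exp (u * s) * Real.exp (-u * a) := fun a => by
      rw [← Real.exp_add]; ring_nf
    simp only [h2, intervalIntegral.integral_mul_const, intervalIntegral.integral_const_mul]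
    rw [integral_exp_const_mul (neg_ne_zero.2 hu.ne')]
    have h3 : Real.exp (u * s) * Real.exp (-u * s) = 1 := by
      rw [← Real.exp_add]; simp
    simp only [neg_mul] at h3 ⊢
    field_simp
    linear_combination (∫ ω, ξ ω * Y.path s ω ∂Y.P) * h3

/-- The covariance of the state with the driving increment, localized to an event of the past. -/
theorem integral_indicator_incr_mul_path (hq : (q : Measure ℝ) = Measure.dirac 0) (hu : 0 < u)
    {s t : ℝ} (hs : 0 ≤ s) (hst : s ≤ t) (ht : t ≤ T) {A : Set Y.Ω}
    (hA : MeasurableSet[Y.𝓕 s.toNNReal] A) :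
    ∫ ω, A.indicator (Y.incr s t) ω * Y.path t ω ∂Y.P
      = √2 * Y.P.real A * (1 - Real.exp (-u * (t - s))) / u := by
  have hA' : MeasurableSet A := Y.𝓕.le _ A hA
  have hξ : MemLp (A.indicator (Y.incr s t)) 2 Y.P := (Y.memLp_incr hst).indicator hA'
  have h0 : ∫ ω, A.indicator (Y.incr s t) ω * Y.path s ω ∂Y.P = 0 := by
    rw [← Y.integral_mul_increment (Real.toNNReal_le_toNNReal hst)
      (η := A.indicator (Y.path s)) ((Y.adapted _).indicator hA)]
    refine integral_congr_ae (.of_forall fun ω => ?_)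
    by_cases h : ω ∈ A <;> simp [h, incr, mul_comm]
  refine volterra_unique (u := u) (s := s) (T := t)
    -- The horizon is `t`, not `T`: the covariance of the increments over `[s, t]` and `[s, r]` is
    -- `r - s` only for `r ≤ t`.
    (c := fun r => √2 * (Y.P.real A * (r - s)))
    (d := fun r => ∫ ω, A.indicator (Y.incr s t) ω * Y.path r ω ∂Y.P)
    (e := fun r => √2 * Y.P.real A * (1 - Real.exp (-u * (r - s))) / u)
    (Y.intervalIntegrable_integral_mul_path hq hu hξ hs hst ht)
    (Continuous.intervalIntegrable (by fun_prop) _ _) (fun r hr => ?_) (fun r hr => ?_) t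
    ⟨hst, le_rfl⟩
  · have h1 : ∫ ω, A.indicator (Y.incr s t) ω * Y.incr s r ω ∂Y.P = Y.P.real A * (r - s) := by
      have h2 := Y.integral_indicator_increment_mul_increment (Real.toNNReal_le_toNNReal hr.1)
        (Real.toNNReal_le_toNNReal hr.2) hA
      rwa [Real.coe_toNNReal _ hs, Real.coe_toNNReal _ (hs.trans hr.1)] at h2
    simp only [Y.integral_mul_path hq hu hξ hs hr.1 (hr.2.trans ht), h0, h1, zero_add]
  · have h2 : ∀ a, Real.exp (-u * (a - s)) = Real.exp (u * s) * Real.exp (-u * a) := fun a => by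
      rw [← Real.exp_add]; ring_nf
    simp only [h2, intervalIntegral.integral_div, intervalIntegral.integral_const_mul]
    rw [intervalIntegral.integral_sub (Continuous.intervalIntegrable (by fun_prop) _ _)
      (Continuous.intervalIntegrable (by fun_prop) _ _), intervalIntegral.integral_const_mul,
      intervalIntegral.integral_const, integral_exp_const_mul (neg_ne_zero.2 hu.ne')]
    have h3 : Real.exp (u * s) * Real.exp (-u * s) = 1 := by
      rw [← Real.exp_add]; simp
    simp only [smul_eq_mul, mul_one, neg_mul] at h3 ⊢
    field_simp
    linear_combination (-Y.P.real A) * h3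

/-- The second moment of the state, localized to an event of the past. -/
theorem integral_indicator_path_sq (hq : (q : Measure ℝ) = Measure.dirac 0) (hu : 0 < u)
    {s t : ℝ} (hs : 0 ≤ s) (hst : s ≤ t) (ht : t ≤ T) {A : Set Y.Ω}
    (hA : MeasurableSet[Y.𝓕 s.toNNReal] A) :
    ∫ ω, A.indicator (Y.path t) ω * Y.path t ω ∂Y.P
      = Real.exp (-2 * u * (t - s)) * (∫ ω, A.indicator (Y.path s) ω * Y.path s ω ∂Y.P)
        + Y.P.real A * ((1 - Real.exp (-2 * u * (t - s))) / u) := by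
  have hA' : MeasurableSet A := Y.𝓕.le _ A hA
  set K : ℝ → ℝ := fun r => ∫ ω, A.indicator (Y.path r) ω * Y.path r ω ∂Y.P with hK
  have hξ : ∀ r ∈ Set.Icc s T, MemLp (A.indicator (Y.path r)) 2 Y.P := fun r hr =>
    (Y.memLp_path hq hu ⟨hs.trans hr.1, hr.2⟩).indicator hA'
  have hcomm : ∀ a b, ∫ ω, A.indicator (Y.path a) ω * Y.path b ω ∂Y.P
      = ∫ ω, A.indicator (Y.path b) ω * Y.path a ω ∂Y.P := fun a b => by
    refine integral_congr_ae (.of_forall fun ω => ?_)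
    by_cases h : ω ∈ A <;> simp [h, mul_comm]
  -- Two-time correlations reduce to `K`, since `1_A X a` is known at time `a` and the conditional
  -- mean decays.
  have hcorr : ∀ r ∈ Set.Icc s T, ∀ a ∈ Set.Icc s r,
      ∫ ω, A.indicator (Y.path r) ω * Y.path a ω ∂Y.P = Real.exp (-u * (r - a)) * K a :=
    fun r hr a ha => by
      rw [hcomm]
      exact Y.integral_past_mul_path hq hu (hs.trans ha.1) ha.2 hr.2 (hξ a ⟨ha.1, ha.2.trans hr.2⟩)
        ((Y.adapted _).indicator (Y.𝓕.mono (Real.toNNReal_le_toNNReal ha.1) _ hA))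
  have hexp : ∀ r a, Real.exp (u * r) * Real.exp (-u * (r - a)) = Real.exp (u * a) :=
    fun r a => by rw [← Real.exp_add]; ring_nf
  -- By `hcorr`, `e^{ur} K r` is `e^{uT}` times the correlation of `X T` with `X r` on `A`, already
  -- integrable in `r` by Fubini.
  have hintK : IntervalIntegrable (fun r => Real.exp (u * r) * K r) volume s T := by
    have h1 := (Y.intervalIntegrable_integral_mul_path hq hu (hξ T ⟨hst.trans ht, le_rfl⟩) hs
      (hst.trans ht) le_rfl).const_mul (Real.exp (u * T))
    refine h1.congr fun r hr => ?_
    rw [Set.uIoc_of_le (hst.trans ht)] at hr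
    rw [hcorr T ⟨hst.trans ht, le_rfl⟩ r ⟨hr.1.le, hr.2⟩, ← mul_assoc, hexp]
  -- Testing the equation at time `r` against `1_A X r` itself replaces Itô's formula. The kernel
  -- `e^{-u(r-a)}` from `hcorr` becomes constant after multiplication by `e^{ur}`, so `e^{ur} K r`
  -- solves a Volterra equation.
  have hsol := volterra_unique (u := u) (s := s) (T := T)
    (c := fun r => Real.exp (u * s) * K s
      + 2 * Y.P.real A * (Real.exp (u * r) - Real.exp (u * s)) / u)
    (d := fun r => Real.exp (u * r) * K r)
    (e := fun r => Real.exp (2 * u * s) * (K s - Y.P.real A / u) * Real.exp (-u * r)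
      + Y.P.real A / u * Real.exp (u * r))
    hintK (Continuous.intervalIntegrable (by fun_prop) _ _) (fun r hr => ?_) (fun r hr => ?_) t
    ⟨hst, ht⟩
  · have h4 : Real.exp (-2 * u * (t - s)) = Real.exp (2 * u * s) * Real.exp (-u * t) ^ 2 := by
      rw [← Real.exp_nat_mul, ← Real.exp_add]; push_cast; ring_nf
    have h5 : Real.exp (-u * t) * Real.exp (u * t) = 1 := by
      rw [← Real.exp_add]; simp
    have h6 : K t = Real.exp (-u * t) * (Real.exp (u * t) * K t) := by
      rw [← mul_assoc, h5, one_mul]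
    change K t = Real.exp (-2 * u * (t - s)) * K s + _
    rw [h6, hsol, h4]
    simp only [neg_mul] at h5 ⊢
    field_simp
    linear_combination Y.P.real A * h5
  · have hincr : ∫ ω, A.indicator (Y.path r) ω * Y.incr s r ω ∂Y.P
        = √2 * Y.P.real A * (1 - Real.exp (-u * (r - s))) / u := by
      rw [← Y.integral_indicator_incr_mul_path hq hu hs hr.1 hr.2 hA]
      refine integral_congr_ae (.of_forall fun ω => ?_)
      by_cases h : ω ∈ A <;> simp [h, mul_comm]
    have hint : ∫ a in s..r, Real.exp (u * a) * K a
        = Real.exp (u * r) * ∫ a in s..r, ∫ ω, A.indicator (Y.path r) ω * Y.path a ω ∂Y.P := by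
      rw [← intervalIntegral.integral_const_mul]
      refine intervalIntegral.integral_congr fun a ha => ?_
      rw [Set.uIcc_of_le hr.1] at ha
      rw [hcorr r hr a ha, ← mul_assoc, hexp]
    have h7 := Y.integral_mul_path hq hu (hξ r hr) hs hr.1 hr.2
    rw [hincr, hcorr r hr s ⟨le_rfl, hr.1⟩] at h7
    rw [hint, show K r = _ from h7, ← hexp r s]
    have h8 : √2 * √2 = 2 := Real.mul_self_sqrt zero_le_two
    field_simp
    linear_combination (Y.P.real A * (1 - Real.exp (-(u * (r - s))))) * h8
  · rw [intervalIntegral.integral_add (Continuous.intervalIntegrable (by fun_prop) _ _)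
      (Continuous.intervalIntegrable (by fun_prop) _ _), intervalIntegral.integral_const_mul,
      intervalIntegral.integral_const_mul, integral_exp_const_mul (neg_ne_zero.2 hu.ne'),
      integral_exp_const_mul hu.ne']
    have h9 : Real.exp (2 * u * s) = Real.exp (u * s) ^ 2 := by
      rw [← Real.exp_nat_mul]; push_cast; ring_nf
    have h10 : Real.exp (u * s) * Real.exp (-u * s) = 1 := by
      rw [← Real.exp_add]; simp
    rw [h9]
    simp only [neg_mul] at h10 ⊢
    field_simp
    linear_combination ((u * K s - Y.P.real A) * Real.exp (u * s)) * h10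

end Trajectory

/-! ### Measurements, histories and conditional laws -/

theorem ratio_le_of_le_mul {a b c : ℝ≥0∞} (hc : 1 ≤ c) (h : a ≤ c * b) : ratio a b ≤ c := by
  rw [ratio]
  split_ifs
  · exact hc
  · exact ENNReal.div_le_of_le_mul h

namespace Trajectory

section Sampling

variable {S : ControlSystem} {π : ℝ → ℝ} {q : ProbabilityMeasure ℝ} {T : ℝ≥0} {m : ℕ}
  (Y : Trajectory S π q T)

theorem measurable_uncurry_Z (hπ : Measurable π) :
    Measurable fun p : ℝ≥0 × Y.Ω => Y.Z p.1 p.2 := by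
  have h1 : Measurable (Function.uncurry Y.X) :=
    measurable_uncurry_of_continuous_of_measurable Y.continuous
      fun t => (Y.adapted t).mono (Y.𝓕.le t) le_rfl
  exact h1.prodMk (hπ.comp h1)

theorem measurable_sample (hπ : Measurable π) (i : Fin m) :
    Measurable (Y.sample (m := m) i) :=
  (Y.measurable_uncurry_Z hπ).comp
    (((measurable_pi_apply i).comp measurable_snd).subtype_val.prodMk measurable_fst)

theorem measurable_history (hπ : Measurable π) (i : Fin m) :
    Measurable (Y.history (m := m) i) :=
  measurable_pi_iff.2 fun j => Y.measurable_sample hπ (j : Fin m)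

instance (𝒯 : Sampler T m) (i : Fin m) : IsMarkovKernel (Y.condLaw 𝒯 i) := by
  unfold condLaw; infer_instance

/-- Integrating the conditional law of a measurement over a set of histories gives the law of the
measurement on the event that the history lies in this set. -/
theorem setLIntegral_condLaw (hπ : Measurable π) (𝒯 : Sampler T m) (i : Fin m)
    {φ : ℝ × ℝ → ℝ≥0∞} (hφ : Measurable φ) {B : Set (Set.Iio i → ℝ × ℝ)} (hB : MeasurableSet B) :
    ∫⁻ h in B, ∫⁻ z, φ z ∂(Y.condLaw 𝒯 i h) ∂((Y.sampleMeasure 𝒯).map (Y.history i))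
      = ∫⁻ p in Y.history i ⁻¹' B, φ (Y.sample i p) ∂(Y.sampleMeasure 𝒯) := by
  have hh := Y.measurable_history hπ i
  have hs := Y.measurable_sample hπ i
  have hφ2 : Measurable fun p : (Set.Iio i → ℝ × ℝ) × ℝ × ℝ => φ p.2 := hφ.comp measurable_snd
  have h1 := Measure.setLIntegral_compProd (μ := (Y.sampleMeasure 𝒯).map (Y.history i))
    (κ := Y.condLaw 𝒯 i) (f := fun p => φ p.2) hφ2 hB MeasurableSet.univ
  simp only [Measure.restrict_univ] at h1
  rw [← h1, condLaw, compProd_map_condDistrib hs.aemeasurable,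
    setLIntegral_map (hB.prod MeasurableSet.univ) hφ2 (hh.prodMk hs)]
  congr 2
  ext p
  simp

theorem sampleMeasure_eq_map_of_dirac {𝒯 : Sampler T m} {τ : Fin m → Set.Icc (0 : ℝ≥0) T}
    (h𝒯 : (𝒯 : Measure (Fin m → Set.Icc (0 : ℝ≥0) T)) = Measure.dirac τ) :
    Y.sampleMeasure 𝒯 = Y.P.map fun ω => (ω, τ) := by
  rw [sampleMeasure, h𝒯, Measure.prod_dirac]

/-- Turns an event about earlier measurements into an event of `𝓕 s`, to which the localized moment
formula applies. -/
theorem measurable_history_of_le (hπ : Measurable π) (i : Fin m)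
    (τ : Fin m → Set.Icc (0 : ℝ≥0) T) {s : ℝ≥0} (hs : ∀ j < i, (τ j : ℝ≥0) ≤ s) :
    Measurable[Y.𝓕 s] fun ω => Y.history i (ω, τ) := by
  refine @measurable_pi_lambda _ _ _ (Y.𝓕 s) _ _ fun j => ?_
  have h1 : Measurable[Y.𝓕 s] (Y.X (τ j)) := (Y.adapted _).mono (Y.𝓕.mono (hs j j.2)) le_rfl
  exact (measurable_id.prodMk hπ).comp h1

end Sampling

/-! ### Bounds on the two mean squared errors -/

section OrnsteinUhlenbeck

variable {umin umax u : ℝ} {q : ProbabilityMeasure ℝ} {T : ℝ≥0}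
  (Y : Trajectory (ouSystem umin umax) (fun _ => u) q T)

theorem setLIntegral_path_sq (hq : (q : Measure ℝ) = Measure.dirac 0) (hu : 0 < u)
    {s t : ℝ} (hs : 0 ≤ s) (hst : s ≤ t) (ht : t ≤ T) {A : Set Y.Ω}
    (hA : MeasurableSet[Y.𝓕 s.toNNReal] A) :
    ∫⁻ ω in A, ENNReal.ofReal (Y.path t ω ^ 2) ∂Y.P
      = ENNReal.ofReal (Real.exp (-2 * u * (t - s))
          * (∫ ω, A.indicator (Y.path s) ω * Y.path s ω ∂Y.P)
        + Y.P.real A * ((1 - Real.exp (-2 * u * (t - s))) / u)) := by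
  have hA' : MeasurableSet A := Y.𝓕.le _ A hA
  rw [← Y.integral_indicator_path_sq hq hu hs hst ht hA, ← ofReal_integral_eq_lintegral_ofReal
    (Y.memLp_path hq hu ⟨hs.trans hst, ht⟩).integrable_sq.integrableOn
    (.of_forall fun _ => sq_nonneg _), ← integral_indicator hA']
  congr 2
  ext ω
  by_cases h : ω ∈ A <;> simp [h, sq]

theorem lintegral_path_sq_le (hq : (q : Measure ℝ) = Measure.dirac 0) (hu : 0 < u)
    {t : ℝ} (ht : t ∈ Set.Icc (0 : ℝ) T) :
    ∫⁻ ω, ENNReal.ofReal (Y.path t ω ^ 2) ∂Y.P ≤ ENNReal.ofReal (1 / u) := by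
  have h0 : ∫ ω, Set.univ.indicator (Y.path 0) ω * Y.path 0 ω ∂Y.P = 0 := by
    refine integral_eq_zero_of_ae ?_
    filter_upwards [Y.path_zero_ae_eq hq] with ω hω
    simp [hω]
  rw [← setLIntegral_univ, Y.setLIntegral_path_sq hq hu le_rfl ht.1 ht.2 MeasurableSet.univ, h0]
  refine ENNReal.ofReal_le_ofReal ?_
  rw [mul_zero, zero_add, probReal_univ, one_mul]
  gcongr
  linarith [Real.exp_pos (-2 * u * (t - 0))]

/-- The contribution of the squared conditional mean is nonnegative and is dropped, leaving the
conditional variance. -/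
theorem le_setLIntegral_path_sq (hq : (q : Measure ℝ) = Measure.dirac 0) (hu : 0 < u)
    {s t : ℝ} (hs : 0 ≤ s) (hst : s ≤ t) (ht : t ≤ T) {A : Set Y.Ω}
    (hA : MeasurableSet[Y.𝓕 s.toNNReal] A) :
    ENNReal.ofReal ((1 - Real.exp (-2 * u * (t - s))) / u) * Y.P A
      ≤ ∫⁻ ω in A, ENNReal.ofReal (Y.path t ω ^ 2) ∂Y.P := by
  rw [Y.setLIntegral_path_sq hq hu hs hst ht hA, ← ofReal_measureReal (measure_ne_top _ _), mul_comm,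
    ← ENNReal.ofReal_mul measureReal_nonneg]
  refine ENNReal.ofReal_le_ofReal (le_add_of_nonneg_left (mul_nonneg (Real.exp_pos _).le
    (integral_nonneg fun ω => ?_)))
  by_cases h : ω ∈ A <;> simp [h, mul_self_nonneg]

theorem lintegral_uniformLaw_sq_le (hq : (q : Measure ℝ) = Measure.dirac 0) (hu : 0 < u) :
    ∫⁻ z, ENNReal.ofReal (z.1 ^ 2) ∂Y.uniformLaw ≤ ENNReal.ofReal (1 / u) := by
  have hφ : Measurable fun z : ℝ × ℝ => ENNReal.ofReal (z.1 ^ 2) := by fun_prop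
  have hZ : Measurable fun p : Y.Ω × ℝ => Y.Z p.2.toNNReal p.1 :=
    (Y.measurable_uncurry_Z measurable_const).comp
      ((measurable_real_toNNReal.comp measurable_snd).prodMk measurable_fst)
  have hφZ : Measurable fun p : Y.Ω × ℝ => ENNReal.ofReal ((Y.Z p.2.toNNReal p.1).1 ^ 2) :=
    hφ.comp hZ
  rw [uniformLaw, lintegral_map hφ hZ, lintegral_prod_symm _ hφZ.aemeasurable]
  calc _ ≤ ∫⁻ _, ENNReal.ofReal (1 / u) ∂(volume[|Set.Icc (0 : ℝ) T]) := by
        refine lintegral_mono_ae ?_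
        filter_upwards [ae_cond_mem measurableSet_Icc] with t ht
        exact Y.lintegral_path_sq_le hq hu ht
    _ ≤ _ := by
        rw [lintegral_const]
        exact mul_le_of_le_one_right' prob_le_one

theorem ae_le_lintegral_condLaw_sq (hq : (q : Measure ℝ) = Measure.dirac 0) (hu : 0 < u) {m : ℕ}
    (hm : 1 ≤ m) (i : Fin m) :
    ∀ᵐ h ∂((Y.sampleMeasure (equispacedSampler T m)).map (Y.history i)),
      ENNReal.ofReal ((1 - Real.exp (-(2 * u * (T / m)))) / u)
        ≤ ∫⁻ z, ENNReal.ofReal (z.1 ^ 2) ∂(Y.condLaw (equispacedSampler T m) i h) := by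
  have hφ : Measurable fun z : ℝ × ℝ => ENNReal.ofReal (z.1 ^ 2) := by fun_prop
  have hh := Y.measurable_history measurable_const i
  have hs := Y.measurable_sample measurable_const i
  have hφs : Measurable fun p => ENNReal.ofReal ((Y.sample i p).1 ^ 2) := hφ.comp hs
  have hm0 : (0 : ℝ) < m := by exact_mod_cast hm
  -- The almost everywhere bound is checked by integrating over each measurable set `B` of
  -- histories.
  refine ae_le_of_forall_setLIntegral_le_of_sigmaFinite measurable_const fun B hB _ => ?_
  set τ : Fin m → Set.Icc (0 : ℝ≥0) T := fun i => ⟨((i : ℕ) + 1 : ℝ≥0) / m * T, zero_le, by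
    refine mul_le_of_le_one_left zero_le (div_le_one_of_le₀ ?_ zero_le)
    exact_mod_cast i.2⟩ with hτ
  have hmap := Y.sampleMeasure_eq_map_of_dirac (𝒯 := equispacedSampler T m) (τ := τ) rfl
  have hpair : Measurable fun ω : Y.Ω => (ω, τ) := measurable_prodMk_right
  -- Indices start at `0`: measurement `i` is taken at `(i+1)T/m`, and all earlier ones by `iT/m`.
  -- For `i = 0` this is the initial time and the history is empty.
  have hs0 : (0 : ℝ) ≤ ((i : ℕ) : ℝ) / m * T := by positivity
  have hst : ((i : ℕ) : ℝ) / m * T ≤ (((i : ℕ) : ℝ) + 1) / m * T := by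
    gcongr; linarith
  have hcoe : ((τ i : ℝ≥0) : ℝ) = (((i : ℕ) : ℝ) + 1) / m * T := by simp [hτ]
  have htT : (((i : ℕ) : ℝ) + 1) / m * T ≤ T := by
    rw [← hcoe]; exact NNReal.coe_le_coe.2 (τ i).2.2
  have hA : MeasurableSet[Y.𝓕 (((i : ℕ) : ℝ) / m * T).toNNReal]
      ((fun ω => Y.history i (ω, τ)) ⁻¹' B) := by
    refine Y.measurable_history_of_le measurable_const i τ (fun j hj => ?_) hB
    rw [← NNReal.coe_le_coe, Real.coe_toNNReal _ hs0]
    simp only [hτ, NNReal.coe_mul, NNReal.coe_div, NNReal.coe_add, NNReal.coe_natCast,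
      NNReal.coe_one]
    gcongr
    exact_mod_cast Nat.succ_le_of_lt (Fin.lt_def.1 hj)
  have hgap : -2 * u * ((((i : ℕ) : ℝ) + 1) / m * T - ((i : ℕ) : ℝ) / m * T)
      = -(2 * u * (T / m)) := by ring
  have key := Y.le_setLIntegral_path_sq hq hu hs0 hst htT hA
  rw [hgap] at key
  rw [setLIntegral_const, Y.setLIntegral_condLaw measurable_const _ i hφ hB,
    Measure.map_apply hh hB, hmap, Measure.map_apply hpair (hh hB),
    setLIntegral_map (hh hB) hφs hpair]
  refine key.trans_eq ?_
  refine lintegral_congr fun ω => ?_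
  simp only [sample, Z, path, ← hcoe, Real.toNNReal_coe]

theorem errorRatio_reward_le (hq : (q : Measure ℝ) = Measure.dirac 0) (hu : 0 < u) (hT : 0 < T)
    {m : ℕ} (hm : 1 ≤ m) (i : Fin m) (α : ℝ) :
    Y.errorRatio (equispacedSampler T m) i (fun z => z.1) (fun z => α * z.1)
      ≤ ENNReal.ofReal (1 + m / (2 * T * u)) := by
  have hφ : Measurable fun z : ℝ × ℝ => ENNReal.ofReal (z.1 ^ 2) := by fun_prop
  have hm0 : (0 : ℝ) < m := by exact_mod_cast hm
  have hT0 : (0 : ℝ) < T := hT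
  have hsq : ∀ z : ℝ × ℝ, ENNReal.ofReal ((α * z.1 - z.1) ^ 2)
      = ENNReal.ofReal ((α - 1) ^ 2) * ENNReal.ofReal (z.1 ^ 2) := fun z => by
    rw [← ENNReal.ofReal_mul (sq_nonneg _)]
    ring_nf
  refine essSup_le_of_ae_le _ ?_
  filter_upwards [Y.ae_le_lintegral_condLaw_sq hq hu hm i] with h hh
  simp only [hsq]
  rw [lintegral_const_mul _ hφ, lintegral_const_mul _ hφ]
  refine ratio_le_of_le_mul (ENNReal.one_le_ofReal.2 (le_add_of_nonneg_right (by positivity))) ?_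
  -- The common factor `(α - 1)²` is removed from a product inequality rather than a quotient, so `α
  -- = 1` needs no separate case.
  rw [mul_left_comm]
  gcongr
  refine (Y.lintegral_uniformLaw_sq_le hq hu).trans (le_trans ?_ (mul_le_mul_right hh _))
  rw [← ENNReal.ofReal_mul (by positivity)]
  refine ENNReal.ofReal_le_ofReal ?_
  have h1 := one_le_one_add_inv_mul (y := 2 * u * (T / m)) (by positivity)
  have h2 : 1 + 1 / (2 * u * (T / m)) = 1 + m / (2 * T * u) := by
    field_simp
  rw [h2] at h1
  rw [← mul_div_assoc]
  gcongr

end OrnsteinUhlenbeck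

end Trajectory

/-! ### Assembly of the coefficient -/

theorem ouSystem_independencyCoeff_le {umin umax : ℝ} (humin : 0 < umin) {T : ℝ≥0} (hT : 0 < T)
    {m : ℕ} (hm : 1 ≤ m) :
    (ouSystem umin umax).independencyCoeff (equispacedSampler T m)
      ≤ ENNReal.ofReal (1 + m / (2 * T * umin)) := by
  have hT0 : (0 : ℝ) < T := hT
  refine iSup_le fun i => max_le ?_ ?_ <;>
    refine iSup₂_le fun π hπ => iSup₂_le fun q hq => iSup_le fun Y => iSup₂_le fun g hg => ?_
  · obtain rfl : g = _ := hg
    -- The only drift in the class is the true one, so both errors vanish.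
    refine essSup_le_of_ae_le _ (.of_forall fun h => ?_)
    refine ratio_le_of_le_mul (ENNReal.one_le_ofReal.2 (le_add_of_nonneg_right (by positivity))) ?_
    simp [ouSystem]
  · obtain ⟨u, hu, rfl⟩ := hπ
    obtain ⟨α, -, rfl⟩ := hg
    obtain rfl : q = _ := hq
    refine (Y.errorRatio_reward_le rfl (humin.trans_le hu.1) hT hm i α).trans
      (ENNReal.ofReal_le_ofReal ?_)
    gcongr
    exact hu.1

end CTRL

theorem proposition2 (umin umax : ℝ) (humin : 0 < umin) (humax : umin ≤ umax)
    (T : ℝ≥0) (hT : 0 < T) (m : ℕ) (hm : 1 ≤ m) :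
    (CTRL.ouSystem umin umax).independencyCoeff (CTRL.equispacedSampler T m)
        ≤ ENNReal.ofReal (1 + m / (2 * T * umin)) ∧
      ((m : ℝ) ≤ 2 * T * umin →
        (CTRL.ouSystem umin umax).independencyCoeff (CTRL.equispacedSampler T m) ≤ 2) := by
  have hT0 : (0 : ℝ) < T := hT
  have h := CTRL.ouSystem_independencyCoeff_le (umax := umax) humin hT hm
  refine ⟨h, fun hmT => h.trans ?_⟩
  rw [← ENNReal.ofReal_ofNat]
  refine ENNReal.ofReal_le_ofReal ?_
  have : (m : ℝ) / (2 * T * umin) ≤ 1 := div_le_one_of_le₀ hmT (by positivity)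
  linarith
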